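/- All graphs are finite, simple and undirected. A matching $M$ in a graph $G$ is uniquely restricted if no other matching in $G$ covers exactly the same set of vertices; $\nu_{ur}(G)$ denotes the maximum size of a uniquely restricted matching in $G$. Let $n(G)$, $m(G)$ and $c(G)$ be the number of vertices, edges and connected components of $G$. A graph is subcubic if its maximum degree is at most $3$. If $G$ is a subcubic graph, then $$\nu_{ur}(G)\ \geq\ \frac{n(G)-c(G)}{2}-\frac{m(G)}{6}.\qquad(*)$$ Moreover, the bound is tight in the following cases. (a) If $G$ is a tree, the right-hand side of $(*)$ equals $\frac{n(G)-1}{3}$, and there are infinitely many (that is, arbitrarily large) subcubic trees $T$ with $\nu_{ur}(T)=\frac{n(T)-1}{3}$. (b) For every integer $k\geq 0$, consider the graphs $G_k$ that arise from the disjoint union of $k$ isolated vertices $u(1),\ldots,u(k)$ and $2k+1$ copies $K(1),\ldots,K(2k+1)$ of $K_{2,3}$ by adding, for every $i\in\{1,\ldots,k\}$, one edge between $u(i)$ and a vertex of $K(2i-1)$, one edge between $u(i)$ and a vertex of $K(2i)$, and one edge between $u(i)$ and a vertex of $K(2i+1)$. The endpoints in the copies can be chosen such that $G_k$ is subcubic,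 and for every such choice $n(G_k)=11k+5$, $m(G_k)=15k+6$, $c(G_k)=1$, and $$\nu_{ur}(G_k)=3k+1=\frac{n(G_k)-c(G_k)}{2}-\frac{m(G_k)}{6}.$$ -/

import Mathlib

/-- A matching `M` in `G` is uniquely restricted if no other matching in `G` covers exactly the
same set of vertices. (For a matching `M`, `M.verts` is the set of vertices covered by `M`.) -/
def SimpleGraph.Subgraph.IsUniquelyRestrictedMatching {V : Type*} {G : SimpleGraph V}
    (M : G.Subgraph) : Prop :=
  M.IsMatching ∧ ∀ M' : G.Subgraph, M'.IsMatching → M'.verts = M.verts → M' = M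

/-- The maximum number of edges of a uniquely restricted matching in the (finite) graph `G`. -/
noncomputable def SimpleGraph.urMatchingNumber {V : Type*} (G : SimpleGraph V) : ℕ :=
  sSup {s : ℕ | ∃ M : G.Subgraph, M.IsUniquelyRestrictedMatching ∧ M.edgeSet.ncard = s}

/-- Every vertex has degree at most three. -/
def SimpleGraph.IsSubcubic {V : Type*} (G : SimpleGraph V) : Prop :=
  ∀ v : V, (G.neighborSet v).encard ≤ 3

/-- The order of a graph. -/
noncomputable def SimpleGraph.order {V : Type*} (_G : SimpleGraph V) : ℕ := Nat.card V

/-- The size of a graph, i.e. its number of edges. -/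
noncomputable def SimpleGraph.size {V : Type*} (G : SimpleGraph V) : ℕ := G.edgeSet.ncard

/-- The number of connected components of a graph. -/
noncomputable def SimpleGraph.numComponents {V : Type*} (G : SimpleGraph V) : ℕ :=
  Nat.card G.ConnectedComponent

/-- The graph that arises from `k` isolated vertices `u 0, …, u (k - 1)` and `2 * k + 1` disjoint
copies `K 0, …, K (2 * k)` of `K_{2,3}` by adding, for every `i < k` and every `j < 3`, one edge
between `u i` and the vertex `a i j` of the copy `K (2 * i + j)`. -/
def SimpleGraph.linkedK23 (k : ℕ) (a : Fin k → Fin 3 → Fin 2 ⊕ Fin 3) :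
    SimpleGraph (Fin k ⊕ (Fin (2 * k + 1) × (Fin 2 ⊕ Fin 3))) where
  Adj x y :=
    match x, y with
    | .inl _, .inl _ => False
    | .inl i, .inr (c, v) => ∃ j : Fin 3, (c : ℕ) = 2 * (i : ℕ) + (j : ℕ) ∧ v = a i j
    | .inr (c, v), .inl i => ∃ j : Fin 3, (c : ℕ) = 2 * (i : ℕ) + (j : ℕ) ∧ v = a i j
    | .inr (c, v), .inr (d, w) => c = d ∧ (completeBipartiteGraph (Fin 2) (Fin 3)).Adj v w
  symm := ⟨by
    rintro (i | ⟨c, v⟩) (j | ⟨d, w⟩) h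
    · exact h
    · exact h
    · exact h
    · exact ⟨h.1.symm, h.2.symm⟩⟩
  loopless := ⟨by
    rintro (i | ⟨c, v⟩) h
    · exact h
    · exact (completeBipartiteGraph (Fin 2) (Fin 3)).irrefl h.2⟩

/-! Cleared of denominators, the bound reads 3n ≤ 3c + m + 6ν, and it is proved by induction on m.
Instead of removing a vertex set S, all edges meeting S are deleted, so n never changes and vertices
of S become components of their own. If at least t edges disappear and at most x components appear,
the step is sound when 3x ≤ t, or when 3x ≤ t + 6 and one matching edge is gained. An edge uv is
gained when every neighbor of u lies in S (`IsURGraph.exists_add_edge`): v is then the only possible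
partner of u.

The choice of S: next to a leaf, isolate its neighbor. Without leaves, root a nontrivial component
and look at its last distance class. A vertex of degree three there is isolated alone: three edges
for one component. Otherwise all vertices of that class have degree two, and for one such u both
neighbors v, w are isolated. Either only u, v, w split off, and three edges pay for them, or exactly
one further piece is cut off, which forces six deleted edges (`exists_cutOffData`).

For tightness the lower bound comes from the theorem itself. The upper bounds give the matching
edges distinct labels: vertices of a vertex cover for the caterpillars, and link vertices and copies
of K_{2,3} for the linked graphs, where two matching edges in one copy would lie on an alternating
4-cycle. -/

namespace SimpleGraph

variable {V : Type*}

/-! ### Isolating vertices: effect on components and edges -/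

/-- The graph obtained from `G` by deleting all edges incident with a vertex in `S`. -/
def isolate (G : SimpleGraph V) (S : Set V) : SimpleGraph V where
  Adj a b := G.Adj a b ∧ a ∉ S ∧ b ∉ S
  symm := ⟨fun _ _ h => ⟨h.1.symm, h.2.2, h.2.1⟩⟩
  loopless := ⟨fun _ h => G.irrefl h.1⟩

lemma isolate_adj {G : SimpleGraph V} {S : Set V} {a b : V} :
    (G.isolate S).Adj a b ↔ G.Adj a b ∧ a ∉ S ∧ b ∉ S := Iff.rfl

lemma isolate_le (G : SimpleGraph V) (S : Set V) : G.isolate S ≤ G := fun _ _ h => h.1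

lemma IsSubcubic.mono {G G' : SimpleGraph V} (h : G.IsSubcubic) (hle : G' ≤ G) :
    G'.IsSubcubic := fun v =>
  (Set.encard_le_encard fun _ hx => hle hx).trans (h v)

/-- A component of `G'` meeting `X` is charged to a vertex of `X` in it, any other one to the
`G`-component of a representative. By `h`, two components of the second kind with the same charge
coincide. -/
lemma numComponents_le_add [Finite V] (G G' : SimpleGraph V) (X : Finset V)
    (h : ∀ x y, G.Reachable x y → G'.Reachable x y ∨ (∃ t ∈ X, G'.Reachable x t) ∨
      ∃ t ∈ X, G'.Reachable y t) :
    G'.numComponents ≤ G.numComponents + X.card := by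
  classical
  have key : Nat.card G'.ConnectedComponent ≤ Nat.card (G.ConnectedComponent ⊕ X) := by
    refine Nat.card_le_card_of_injective (fun C =>
      if hC : ∃ t : X, G'.connectedComponentMk t = C then Sum.inr hC.choose
      else Sum.inl (G.connectedComponentMk (Quot.out C))) ?_
    intro C D hCD
    have hout : ∀ C : G'.ConnectedComponent, G'.connectedComponentMk (Quot.out C) = C :=
      fun C => Quot.out_eq C
    by_cases hC : ∃ t : X, G'.connectedComponentMk t = C <;>
      by_cases hD : ∃ t : X, G'.connectedComponentMk t = D
    · simp only [hC, hD, dif_pos, Sum.inr.injEq] at hCD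
      rw [← hC.choose_spec, ← hD.choose_spec, hCD]
    · simp [hC, hD] at hCD
    · simp [hC, hD] at hCD
    · simp only [hC, hD, dif_neg, not_false_eq_true, Sum.inl.injEq] at hCD
      rcases h _ _ (ConnectedComponent.exact hCD) with h | ⟨t, ht, h⟩ | ⟨t, ht, h⟩
      · rw [← hout C, ← hout D]; exact ConnectedComponent.sound h
      · exact absurd ⟨⟨t, ht⟩, by rw [← hout C]; exact ConnectedComponent.sound h.symm⟩ hC
      · exact absurd ⟨⟨t, ht⟩, by rw [← hout D]; exact ConnectedComponent.sound h.symm⟩ hD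
  simpa [numComponents, Nat.card_sum] using key

lemma size_isolate_add_card_le [Finite V] (G : SimpleGraph V) (S : Set V) (T : Finset (Sym2 V))
    (hT : ∀ e ∈ T, e ∈ G.edgeSet ∧ ∃ s ∈ S, s ∈ e) :
    (G.isolate S).size + T.card ≤ G.size := by
  have hdisj : Disjoint (G.isolate S).edgeSet (T : Set (Sym2 V)) := by
    rw [Set.disjoint_left]
    intro e he heT
    obtain ⟨s, hs, hse⟩ := (hT e heT).2
    induction e with
    | _ a b =>
      rw [mem_edgeSet, isolate_adj] at he
      rcases Sym2.mem_iff.1 hse with rfl | rfl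
      · exact he.2.1 hs
      · exact he.2.2 hs
  unfold size
  rw [← Set.ncard_coe_finset, ← Set.ncard_union_eq hdisj]
  refine Set.ncard_le_ncard (Set.union_subset (edgeSet_mono (G.isolate_le S)) ?_)
  exact fun e he => (hT e he).1

/-- Follow a walk from `x` up to its first vertex in `S`; the vertex before it is `t`. -/
lemma reachable_isolate_or {G : SimpleGraph V} (S : Set V) {x y : V} (h : G.Reachable x y) :
    (G.isolate S).Reachable x y ∨ ∃ s ∈ S, x = s ∨ ∃ t, G.Adj t s ∧ (G.isolate S).Reachable x t := by
  obtain ⟨p⟩ := h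
  induction p with
  | nil => exact .inl .rfl
  | @cons a b c hab p ih =>
    by_cases ha : a ∈ S
    · exact .inr ⟨a, ha, .inl rfl⟩
    by_cases hb : b ∈ S
    · exact .inr ⟨b, hb, .inr ⟨a, hab, .rfl⟩⟩
    have hab' : (G.isolate S).Reachable a b := Adj.reachable ⟨hab, ha, hb⟩
    rcases ih with ih | ⟨s, hs, rfl | ⟨t, hts, ht⟩⟩
    · exact .inl (hab'.trans ih)
    · exact absurd hs hb
    · exact .inr ⟨s, hs, .inr ⟨t, hts, hab'.trans ht⟩⟩

/-! ### Uniquely restricted matchings as graphs on the full vertex set -/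

/-- Each vertex has at most one neighbor. -/
def IsMatchingGraph (H : SimpleGraph V) : Prop :=
  ∀ ⦃a b c⦄, H.Adj a b → H.Adj a c → b = c

/-- `H` is the edge set of a uniquely restricted matching of `G`, viewed as a graph. -/
structure IsURGraph (G H : SimpleGraph V) : Prop where
  le : H ≤ G
  isMatching : H.IsMatchingGraph
  unique : ∀ K ≤ G, K.IsMatchingGraph → K.support = H.support → K = H

lemma Subgraph.IsMatching.isMatchingGraph {G : SimpleGraph V} {M : G.Subgraph}
    (hM : M.IsMatching) : M.spanningCoe.IsMatchingGraph :=
  fun _ _ _ hb hc => hM.eq_of_adj_left hb hc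

lemma bddAbove_ur [Finite V] (G : SimpleGraph V) :
    BddAbove {s : ℕ | ∃ M : G.Subgraph, M.IsUniquelyRestrictedMatching ∧
      M.edgeSet.ncard = s} := by
  refine ⟨G.size, ?_⟩
  rintro _ ⟨M, -, rfl⟩
  exact Set.ncard_le_ncard M.edgeSet_subset

lemma urMatchingNumber_le (G : SimpleGraph V) (n : ℕ)
    (h : ∀ M : G.Subgraph, M.IsUniquelyRestrictedMatching → M.edgeSet.ncard ≤ n) :
    G.urMatchingNumber ≤ n := by
  by_cases hne : {s : ℕ | ∃ M : G.Subgraph, M.IsUniquelyRestrictedMatching ∧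
      M.edgeSet.ncard = s}.Nonempty
  · refine csSup_le hne ?_
    rintro _ ⟨M, hM, rfl⟩
    exact h M hM
  -- The supremum of the empty set of naturals is 0.
  · rw [Set.not_nonempty_iff_eq_empty] at hne
    simp [urMatchingNumber, hne]

lemma IsURGraph.ncard_le [Finite V] {G H : SimpleGraph V} (h : G.IsURGraph H) :
    H.edgeSet.ncard ≤ G.urMatchingNumber := by
  let M : G.Subgraph :=
    { verts := H.support
      Adj := H.Adj
      adj_sub := fun hab => h.le hab
      edge_vert := fun hab => ⟨_, hab⟩
      symm := H.symm }
  refine le_csSup (bddAbove_ur G) ⟨M, ⟨?_, ?_⟩, ?_⟩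
  · rintro v ⟨w, hw⟩
    exact ⟨w, hw, fun y hy => h.isMatching hy hw⟩
  · intro M' hM' hv
    have hs : M'.spanningCoe.support = M'.verts := hM'.support_eq_verts
    have hK := h.unique M'.spanningCoe M'.spanningCoe_le hM'.isMatchingGraph (hs.trans hv)
    refine Subgraph.ext hv ?_
    ext a b
    exact iff_of_eq (congrArg (fun K : SimpleGraph V => K.Adj a b) hK)
  · rfl

/-- A competitor in `G` has the same support as `H`, hence avoids `S` and already lives in
`G.isolate S`. -/
lemma IsURGraph.of_isolate {G H : SimpleGraph V} {S : Set V} (h : (G.isolate S).IsURGraph H) :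
    G.IsURGraph H := by
  refine ⟨h.le.trans (G.isolate_le S), h.isMatching, fun K hK hm hs => h.unique K ?_ hm hs⟩
  have : ∀ x ∈ K.support, x ∉ S := by
    intro x hx
    rw [hs] at hx
    obtain ⟨y, hy⟩ := hx
    exact (h.le hy).2.1
  exact fun a b hab => ⟨hK hab, this a ⟨b, hab⟩, this b ⟨a, hab.symm⟩⟩

/-- `H` covers neither `S` nor `u`. A competitor of `H + uv` must match `u` into `S`, where only `v`
is covered, so it contains `uv`; its remainder is a competitor of `H`. -/
lemma IsURGraph.exists_add_edge [Finite V] {G H : SimpleGraph V} {S : Set V} {u v : V}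
    (h : (G.isolate S).IsURGraph H) (huv : G.Adj u v) (hN : ∀ y, G.Adj u y → y ∈ S) :
    ∃ H', G.IsURGraph H' ∧ H'.edgeSet.ncard = H.edgeSet.ncard + 1 := by
  have hS : ∀ s ∈ S, ∀ y, ¬ H.Adj s y := fun s hs y hy => (h.le hy).2.1 hs
  have hu : ∀ y, ¬ H.Adj u y := fun y hy => (h.le hy).2.2 (hN y (h.le hy).1)
  have hv : ∀ y, ¬ H.Adj v y := hS v (hN v huv)
  have hne := huv.ne
  let H' : SimpleGraph V :=
    { Adj := fun a b => H.Adj a b ∨ (a = u ∧ b = v) ∨ (a = v ∧ b = u)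
      symm := ⟨by
        rintro a b (h | ⟨rfl, rfl⟩ | ⟨rfl, rfl⟩)
        exacts [.inl h.symm, .inr (.inr ⟨rfl, rfl⟩), .inr (.inl ⟨rfl, rfl⟩)]⟩
      loopless := ⟨by
        rintro a (h | ⟨rfl, h⟩ | ⟨rfl, h⟩)
        exacts [H.irrefl h, hne h, hne h.symm]⟩ }
  have hsupp : ∀ x, x ∈ H'.support ↔ x ∈ H.support ∨ x = u ∨ x = v := by
    intro x
    constructor
    · rintro ⟨y, h | ⟨rfl, rfl⟩ | ⟨rfl, rfl⟩⟩
      exacts [.inl ⟨y, h⟩, .inr (.inl rfl), .inr (.inr rfl)]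
    · rintro (⟨y, h⟩ | rfl | rfl)
      exacts [⟨y, .inl h⟩, ⟨v, .inr (.inl ⟨rfl, rfl⟩)⟩, ⟨u, .inr (.inr ⟨rfl, rfl⟩)⟩]
  refine ⟨H', ⟨?_, ?_, ?_⟩, ?_⟩
  · rintro a b (hab | ⟨rfl, rfl⟩ | ⟨rfl, rfl⟩)
    exacts [(h.le hab).1, huv, huv.symm]
  · rintro a b c (hb | ⟨rfl, rfl⟩ | ⟨rfl, rfl⟩) (hc | ⟨h1, rfl⟩ | ⟨h1, rfl⟩)
    · exact h.isMatching hb hc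
    all_goals first | rfl | (subst h1; first | exact absurd hb (hu _) | exact absurd hb (hv _) |
      exact absurd rfl hne) | exact absurd hc (hu _) | exact absurd hc (hv _)
  · intro K hK hm hs
    have hKs : ∀ x, x ∈ K.support ↔ x ∈ H.support ∨ x = u ∨ x = v := by
      intro x; rw [hs]; exact hsupp x
    have hKuv : K.Adj u v := by
      obtain ⟨y, hy⟩ := (hKs u).2 (.inr (.inl rfl))
      have hyS := hN y (hK hy)
      rcases (hKs y).1 ⟨u, hy.symm⟩ with ⟨z, hz⟩ | rfl | rfl
      · exact absurd hz (hS y hyS z)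
      · exact absurd hy (K.irrefl)
      · exact hy
    -- The competitor without the edge `uv`.
    let K0 : SimpleGraph V := K.isolate {u, v}
    have hK0 : K0 = H := by
      refine h.unique K0 ?_ (fun a b c hb hc => hm hb.1 hc.1) ?_
      · intro a b hab
        have aux : ∀ x, x ∈ K.support → x ∉ ({u, v} : Set V) → x ∉ S := by
          intro x hx hx' hxS
          rcases (hKs x).1 hx with ⟨z, hz⟩ | rfl | rfl
          · exact hS x hxS z hz
          · simp at hx'
          · simp at hx'
        exact ⟨hK hab.1, aux a ⟨b, hab.1⟩ hab.2.1, aux b ⟨a, hab.1.symm⟩ hab.2.2⟩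
      · ext x
        constructor
        · rintro ⟨y, hy⟩
          rcases (hKs x).1 ⟨y, hy.1⟩ with hx | rfl | rfl
          · exact hx
          · exact absurd hy.2.1 (by simp)
          · exact absurd hy.2.1 (by simp)
        · rintro ⟨y, hy⟩
          obtain ⟨z, hz⟩ := (hKs x).2 (.inl ⟨y, hy⟩)
          have hxu : x ≠ u := fun h => hu y (h ▸ hy)
          have hxv : x ≠ v := fun h => hv y (h ▸ hy)
          refine ⟨z, hz, by simp [hxu, hxv], ?_⟩
          rintro (rfl | rfl)
          · exact hxv (hm hz.symm hKuv)
          · exact hxu (hm hz.symm hKuv.symm)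
    ext a b
    constructor
    · intro hab
      by_cases hau : a = u
      · exact .inr (.inl ⟨hau, hm (hau ▸ hab) hKuv⟩)
      by_cases hav : a = v
      · exact .inr (.inr ⟨hav, hm (hav ▸ hab) hKuv.symm⟩)
      refine .inl (hK0 ▸ ⟨hab, by simp [hau, hav], ?_⟩)
      rintro (rfl | rfl)
      · exact hav (hm hab.symm hKuv)
      · exact hau (hm hab.symm hKuv.symm)
    · rintro (hab | ⟨rfl, rfl⟩ | ⟨rfl, rfl⟩)
      · rw [← hK0] at hab; exact hab.1
      · exact hKuv
      · exact hKuv.symm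
  · have : H'.edgeSet = insert s(u, v) H.edgeSet := by
      ext e
      induction e with
      | _ a b =>
        simp only [mem_edgeSet, Set.mem_insert_iff, Sym2.eq_iff]
        exact or_comm
    rw [this, Set.ncard_insert_of_notMem (by rw [mem_edgeSet]; exact hu v)]

/-! ### The accounting of one induction step -/

/-- `G` has a uniquely restricted matching of size at least `(n - c) / 2 - m / 6`. -/
def HasURBound (G : SimpleGraph V) : Prop :=
  ∃ H, G.IsURGraph H ∧
    3 * Nat.card V ≤ 3 * G.numComponents + G.size + 6 * H.edgeSet.ncard

lemma hasURBound_of_isolate [Finite V] {G : SimpleGraph V} (S : Set V) (X : Finset V)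
    (T : Finset (Sym2 V)) (hG : (G.isolate S).HasURBound)
    (hT : ∀ e ∈ T, e ∈ G.edgeSet ∧ ∃ s ∈ S, s ∈ e)
    (hX : ∀ x y, G.Reachable x y → (G.isolate S).Reachable x y ∨
      (∃ t ∈ X, (G.isolate S).Reachable x t) ∨ ∃ t ∈ X, (G.isolate S).Reachable y t)
    (hle : 3 * X.card ≤ T.card) : G.HasURBound := by
  obtain ⟨H, hH, hb⟩ := hG
  have h1 := size_isolate_add_card_le G S T hT
  have h2 := numComponents_le_add G _ X hX
  exact ⟨H, hH.of_isolate, by omega⟩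

/-- The additional 6 is the weight of the gained matching edge `uv`. -/
lemma hasURBound_of_isolate_of_adj [Finite V] {G : SimpleGraph V} (S : Set V) (X : Finset V)
    (T : Finset (Sym2 V)) (hG : (G.isolate S).HasURBound)
    (hT : ∀ e ∈ T, e ∈ G.edgeSet ∧ ∃ s ∈ S, s ∈ e)
    (hX : ∀ x y, G.Reachable x y → (G.isolate S).Reachable x y ∨
      (∃ t ∈ X, (G.isolate S).Reachable x t) ∨ ∃ t ∈ X, (G.isolate S).Reachable y t)
    {u v : V} (huv : G.Adj u v) (hN : ∀ y, G.Adj u y → y ∈ S)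
    (hle : 3 * X.card ≤ T.card + 6) : G.HasURBound := by
  obtain ⟨H, hH, hb⟩ := hG
  have h1 := size_isolate_add_card_le G S T hT
  have h2 := numComponents_le_add G _ X hX
  obtain ⟨H', hH', hc⟩ := hH.exists_add_edge huv hN
  exact ⟨H', hH', by omega⟩

lemma size_isolate_lt [Finite V] {G : SimpleGraph V} {S : Set V} {a b : V} (hab : G.Adj a b)
    (ha : a ∈ S) : (G.isolate S).size < G.size := by
  have := size_isolate_add_card_le G S {s(a, b)} (by
    intro e he
    rw [Finset.mem_singleton] at he
    subst he
    exact ⟨hab, a, ha, by simp⟩)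
  simpa using this

lemma hasURBound_of_forall_not_adj [Finite V] {G : SimpleGraph V} (h : ∀ a b, ¬ G.Adj a b) :
    G.HasURBound := by
  have hb : G = ⊥ := by ext a b; simpa using h a b
  subst hb
  refine ⟨⊥, ⟨le_rfl, fun _ _ _ h => absurd h (by simp), fun K hK _ _ => le_bot_iff.1 hK⟩, ?_⟩
  have : Nat.card V ≤ (⊥ : SimpleGraph V).numComponents := by
    refine Nat.card_le_card_of_injective (connectedComponentMk ⊥) fun a b hab => ?_
    exact reachable_bot.1 (ConnectedComponent.exact hab)
  omega

lemma IsSubcubic.eq_of_adj {G : SimpleGraph V} (hG : G.IsSubcubic) {v a b c d : V}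
    (ha : G.Adj v a) (hb : G.Adj v b) (hc : G.Adj v c) (hd : G.Adj v d)
    (hab : a ≠ b) (hac : a ≠ c) (hbc : b ≠ c) : d = a ∨ d = b ∨ d = c := by
  classical
  by_contra! hne
  have h4 : ({a, b, c, d} : Finset V).card = 4 := by
    rw [Finset.card_eq_succ]
    refine ⟨a, {b, c, d}, ?_, rfl, ?_⟩
    · simp [hab, hac, hne.1.symm]
    · exact Finset.card_eq_three.2 ⟨b, c, d, hbc, hne.2.1.symm, hne.2.2.symm, rfl⟩
  have hsub : ((({a, b, c, d} : Finset V)) : Set V) ⊆ G.neighborSet v := by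
    intro x hx
    simp only [Finset.coe_insert, Finset.coe_singleton, Set.mem_insert_iff,
      Set.mem_singleton_iff] at hx
    rcases hx with rfl | rfl | rfl | rfl <;> assumption
  have := (Set.encard_le_encard hsub).trans (hG v)
  rw [Set.encard_coe_eq_coe_finsetCard, h4] at this
  exact absurd this (by decide)

/-- Isolating `v` deletes deg v edges and creates at most deg v components, and 3 deg v ≤ deg v + 6
because deg v ≤ 3. -/
lemma hasURBound_of_leaf [Finite V] {G : SimpleGraph V} (hG : G.IsSubcubic)
    (ih : ∀ G' : SimpleGraph V, G'.IsSubcubic → G'.size < G.size → G'.HasURBound)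
    {u v : V} (huv : G.Adj u v) (hu : ∀ y, G.Adj u y → y = v) : G.HasURBound := by
  classical
  let X : Finset V := (Set.toFinite (G.neighborSet v)).toFinset
  have hX : ∀ x, x ∈ X ↔ G.Adj v x := by simp [X]
  have hX3 : X.card ≤ 3 := by
    have := hG v
    rw [← (Set.toFinite (G.neighborSet v)).coe_toFinset,
      Set.encard_coe_eq_coe_finsetCard] at this
    exact_mod_cast this
  have hinj : Function.Injective (fun x => s(v, x)) := fun x y h => Sym2.congr_right.1 h
  refine hasURBound_of_isolate_of_adj {v} X (X.image fun x => s(v, x))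
    (ih _ (hG.mono (isolate_le _ _)) (size_isolate_lt huv.symm rfl)) ?_ ?_ huv hu ?_
  · intro e he
    obtain ⟨x, hx, rfl⟩ := Finset.mem_image.1 he
    exact ⟨(hX x).1 hx, v, rfl, by simp⟩
  · intro x y hxy
    rcases reachable_isolate_or {v} hxy with h | ⟨_, rfl, rfl | ⟨t, ht, h⟩⟩
    · exact .inl h
    · rcases reachable_isolate_or {x} hxy.symm with h | ⟨_, rfl, rfl | ⟨t, ht, h⟩⟩
      · exact .inl h.symm
      · exact .inl .rfl
      · exact .inr (.inr ⟨t, (hX t).2 ht.symm, h⟩)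
    · exact .inr (.inl ⟨t, (hX t).2 ht.symm, h⟩)
  · rw [Finset.card_image_of_injective _ hinj]
    omega

/-! ### Distance classes from a root -/

lemma exists_adj_dist_succ {G : SimpleGraph V} {r z : V} (h : G.Reachable r z)
    (hne : G.dist r z ≠ 0) : ∃ p, G.Adj z p ∧ G.Reachable r p ∧ G.dist r p + 1 = G.dist r z := by
  obtain ⟨w, hw⟩ := h.symm.exists_walk_length_eq_dist
  rw [dist_comm] at hw
  cases w with
  | nil => simp at hne
  | @cons _ p _ hzp w =>
    have hp : G.Reachable r p := w.reverse.reachable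
    refine ⟨p, hzp, hp, ?_⟩
    have h1 : G.dist r p ≤ w.length := by simpa using dist_le w.reverse
    obtain ⟨w', hw'⟩ := hp.exists_walk_length_eq_dist
    have h2 := dist_le (w'.concat hzp.symm)
    rw [Walk.length_concat] at h2
    rw [Walk.length_cons] at hw
    omega

/-- Isolating vertices in the last two distance classes leaves the remaining vertices that are
not in the last class connected to the root. -/
lemma reachable_isolate_root {G : SimpleGraph V} {r : V} {S : Set V} {D : ℕ}
    (hS : ∀ s ∈ S, D ≤ G.dist r s + 1) {z : V} (hz : G.Reachable r z) (hzS : z ∉ S)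
    (hzD : G.dist r z + 1 ≤ D) : (G.isolate S).Reachable z r := by
  induction hd : G.dist r z generalizing z with
  | zero => rw [hz.dist_eq_zero_iff] at hd; rw [hd]
  | succ d ihd =>
    obtain ⟨p, hzp, hrp, hp⟩ := exists_adj_dist_succ hz (by omega)
    have hpS : p ∉ S := fun h => by have := hS p h; omega
    exact (Adj.reachable (G := G.isolate S) ⟨hzp, hzS, hpS⟩).trans
      (ihd hrp hpS (by omega) (by omega))

/-- If every vertex in the component of the root either reaches the root or a vertex of `X`
after isolating `S`, then no other components are affected. -/
lemma reachable_isolate_of_component {G : SimpleGraph V} {r : V} {S : Set V} {X : Finset V}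
    (hS : ∀ s ∈ S, G.Reachable r s)
    (h : ∀ z, G.Reachable r z →
      (G.isolate S).Reachable z r ∨ ∃ t ∈ X, (G.isolate S).Reachable z t) (x y : V)
    (hxy : G.Reachable x y) : (G.isolate S).Reachable x y ∨
      (∃ t ∈ X, (G.isolate S).Reachable x t) ∨ ∃ t ∈ X, (G.isolate S).Reachable y t := by
  by_cases hx : G.Reachable r x
  · rcases h x hx with h1 | h1
    · rcases h y (hx.trans hxy) with h2 | h2
      · exact .inl (h1.trans h2.symm)
      · exact .inr (.inr h2)
    · exact .inr (.inl h1)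
  · rcases reachable_isolate_or S hxy with h | ⟨s, hs, rfl | ⟨t, ht, h⟩⟩
    · exact .inl h
    · exact absurd (hS _ hs) hx
    · exact absurd ((hS s hs).trans (ht.symm.reachable.trans
        (h.mono (isolate_le _ _)).symm)) hx

/-- No shortest path from the root to another vertex passes through the deepest vertex `u`, so
isolating `u` creates one component and deletes three edges: 3 · 1 ≤ 3. -/
lemma hasURBound_of_deepest_degree_three [Finite V] {G : SimpleGraph V} (hG : G.IsSubcubic)
    (ih : ∀ G' : SimpleGraph V, G'.IsSubcubic → G'.size < G.size → G'.HasURBound)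
    {r u a b c : V} (hmax : ∀ z, G.Reachable r z → G.dist r z ≤ G.dist r u)
    (hu : G.Reachable r u) (hu0 : G.dist r u ≠ 0)
    (ha : G.Adj u a) (hb : G.Adj u b) (hc : G.Adj u c)
    (hab : a ≠ b) (hac : a ≠ c) (hbc : b ≠ c) : G.HasURBound := by
  classical
  have hinj : Function.Injective (fun x => s(u, x)) := fun x y h => Sym2.congr_right.1 h
  have hS : ∀ s ∈ ({u} : Set V), G.dist r u ≤ G.dist r s + 1 := by
    rintro _ rfl; omega
  refine hasURBound_of_isolate {u} {u} (({a, b, c} : Finset V).image fun x => s(u, x))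
    (ih _ (hG.mono (isolate_le _ _)) (size_isolate_lt ha rfl)) ?_
    (reachable_isolate_of_component (r := r) (by rintro _ rfl; exact hu) ?_) ?_
  · intro e he
    obtain ⟨x, hx, rfl⟩ := Finset.mem_image.1 he
    refine ⟨?_, u, rfl, by simp⟩
    simp only [Finset.mem_insert, Finset.mem_singleton] at hx
    rcases hx with rfl | rfl | rfl <;> assumption
  · intro z hz
    by_cases hzu : z = u
    · exact .inr ⟨u, by simp, by rw [hzu]⟩
    left
    by_cases hzD : G.dist r z + 1 ≤ G.dist r u
    · exact reachable_isolate_root hS hz hzu hzD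
    · have := hmax z hz
      obtain ⟨p, hzp, hrp, hp⟩ := exists_adj_dist_succ hz (by omega)
      have hpu : p ∉ ({u} : Set V) := by rintro rfl; omega
      exact (Adj.reachable (G := G.isolate {u}) ⟨hzp, hzu, hpu⟩).trans
        (reachable_isolate_root hS hrp hpu (by omega))
  · rw [Finset.card_image_of_injective _ hinj, Finset.card_eq_three.2 ⟨a, b, c, hab, hac, hbc, rfl⟩]
    simp

lemma dist_le_dist_add_one_of_adj {G : SimpleGraph V} {r a b : V} (ha : G.Reachable r a)
    (hab : G.Adj a b) : G.dist r b ≤ G.dist r a + 1 := by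
  obtain ⟨w, hw⟩ := ha.exists_walk_length_eq_dist
  have := dist_le (w.concat hab)
  rwa [Walk.length_concat, hw] at this

lemma dist_ne_zero_of_dist_eq_of_ne {G : SimpleGraph V} {r v w : V} (hv : G.Reachable r v)
    (hw : G.Reachable r w) (h : G.dist r v = G.dist r w) (hne : v ≠ w) : G.dist r v ≠ 0 := by
  intro h0
  have h1 := hv.dist_eq_zero_iff.1 h0
  have h2 := hw.dist_eq_zero_iff.1 (h ▸ h0)
  exact hne (h1.symm.trans h2)

/-! ### Deepest vertices of degree two -/

/-- Every vertex of the last distance class `D` has exactly two neighbors, one of which is closer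
to the root. -/
def DeepestDegreeTwo (G : SimpleGraph V) (r : V) (D : ℕ) : Prop :=
  ∀ z, G.Reachable r z → G.dist r z = D → ∃ p q, p ≠ q ∧ G.Adj z p ∧ G.Adj z q ∧
    G.Reachable r p ∧ G.dist r p + 1 = D ∧ ∀ y, G.Adj z y → y = p ∨ y = q

/-- The neighborhoods of the two neighbors `v` and `w` of a deepest vertex `u` when isolating
`v` and `w` cuts off a further vertex of the last distance class. -/
structure CutOffData (G : SimpleGraph V) (r : V) (D : ℕ) (u v w a b c d : V) : Prop where
  dist_v : G.dist r v + 1 = D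
  dist_w : G.dist r w + 1 = D
  adj_va : G.Adj v a
  adj_wb : G.Adj w b
  adj_vc : G.Adj v c
  adj_wd : G.Adj w d
  dist_a : G.dist r a = D
  dist_b : G.dist r b = D
  dist_c : G.dist r c + 2 = D
  dist_d : G.dist r d + 2 = D
  a_ne : a ≠ u
  b_ne : b ≠ u
  reachable : (G.isolate {v, w}).Reachable a b

lemma CutOffData.swap {G : SimpleGraph V} {r : V} {D : ℕ} {u v w a b c d : V}
    (h : CutOffData G r D u v w a b c d) : CutOffData G r D u w v b a d c :=
  ⟨h.dist_w, h.dist_v, h.adj_wb, h.adj_va, h.adj_wd, h.adj_vc, h.dist_b, h.dist_a, h.dist_d,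
    h.dist_c, h.b_ne, h.a_ne, by rw [Set.pair_comm]; exact h.reachable.symm⟩

/-- Let `q` be the second neighbor of the cut-off vertex `z`. If `q = w`, then `a = b = z`.
Otherwise `q` is cut off too, hence lies in the last class, and its parent must be `w`, so `a = z`
and `b = q`. -/
lemma exists_cutOffData {G : SimpleGraph V} (hG : G.IsSubcubic) {r u v w z : V} {D : ℕ}
    (hmax : ∀ z, G.Reachable r z → G.dist r z ≤ D) (hdeg : G.DeepestDegreeTwo r D)
    (hu : G.Reachable r u) (huD : G.dist r u = D) (huv : G.Adj u v) (huw : G.Adj u w)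
    (hvw : v ≠ w) (hN : ∀ y, G.Adj u y → y = v ∨ y = w) (hvD : G.dist r v + 1 = D)
    (hz : G.Reachable r z) (hzD : G.dist r z = D) (hzu : z ≠ u) (hzS : z ∉ ({v, w} : Set V))
    (hbad : ¬ (G.isolate {v, w}).Reachable z r) (hzv : G.Adj z v) :
    ∃ a b c d, CutOffData G r D u v w a b c d := by
  have hv : G.Reachable r v := hu.trans huv.reachable
  have hw : G.Reachable r w := hu.trans huw.reachable
  have hwD : D ≤ G.dist r w + 1 := huD ▸ dist_le_dist_add_one_of_adj hw huw.symm
  have hS : ∀ s ∈ ({v, w} : Set V), D ≤ G.dist r s + 1 := by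
    rintro s (rfl | rfl)
    · omega
    · exact hwD
  have hzvne : z ≠ v := fun h => hzS (by simp [h])
  have hzwne : z ≠ w := fun h => hzS (by simp [h])
  have parents : G.dist r w + 1 = D → ∃ c d, G.Adj v c ∧ G.Adj w d ∧ G.dist r c + 2 = D ∧
      G.dist r d + 2 = D := by
    intro h
    have hne := dist_ne_zero_of_dist_eq_of_ne hv hw (by omega) hvw
    obtain ⟨c, hc, -, hcd⟩ := exists_adj_dist_succ hv hne
    obtain ⟨d, hd, -, hdd⟩ := exists_adj_dist_succ hw (by omega)
    exact ⟨c, d, hc, hd, by omega, by omega⟩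
  obtain ⟨q, hqv, hzq, hzN⟩ : ∃ q, q ≠ v ∧ G.Adj z q ∧ ∀ y, G.Adj z y → y = v ∨ y = q := by
    obtain ⟨p, q, hpq, hzp, hzq, -, -, hy⟩ := hdeg z hz hzD
    rcases hy v hzv with rfl | rfl
    · exact ⟨q, hpq.symm, hzq, hy⟩
    · exact ⟨p, hpq, hzp, fun y h => (hy y h).symm⟩
  by_cases hqw : q = w
  · subst hqw
    -- In the last class, `q` would have only the neighbors `z` and `u`, neither closer to the root.
    have hqD : G.dist r q ≠ D := by
      intro h
      obtain ⟨p, p', hpp, hqp, hqp', -, hpD, hy⟩ := hdeg q hw h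
      rcases hy z hzq.symm with rfl | rfl
      · omega
      rcases hy u huw.symm with rfl | rfl
      · omega
      exact hzu rfl
    have hq := hmax q hw
    obtain ⟨c, d, hc, hd, hcD, hdD⟩ := parents (by omega)
    exact ⟨z, z, c, d, hvD, by omega, hzv.symm, hzq.symm, hc, hd, hzD, hzD, hcD, hdD, hzu, hzu,
      .rfl⟩
  · have hqS : q ∉ ({v, w} : Set V) := by simp [hqv, hqw]
    have hzq' : (G.isolate {v, w}).Reachable z q := Adj.reachable ⟨hzq, hzS, hqS⟩
    have hrq : G.Reachable r q := hz.trans hzq.reachable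
    have hqD : G.dist r q = D := by
      by_contra hne
      have := hmax q hrq
      exact hbad (hzq'.trans (reachable_isolate_root hS hrq hqS (by omega)))
    have hqu : q ≠ u := by
      rintro rfl
      rcases hN z hzq.symm with h | h
      exacts [hzvne h, hzwne h]
    obtain ⟨p, -, -, hqp, -, hrp, hpD, -⟩ := hdeg q hrq hqD
    by_cases hpS : p ∈ ({v, w} : Set V)
    -- If the parent of `q` were `v`, the neighbors of `v` would be `u`, `z`, `q`, all in the last
    -- class. Then `v` has no parent, so it is the root; but then `w`, at distance 1, would be a
    -- fourth neighbor.
    · rcases hpS with rfl | rfl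
      · exfalso
        have hnbr := fun {y} (h : G.Adj p y) =>
          hG.eq_of_adj huv.symm hzv.symm hqp.symm h hzu.symm hqu.symm hzq.ne
        by_cases h0 : G.dist r p = 0
        · have hrp' : r = p := hv.dist_eq_zero_iff.1 h0
          have hw1 : G.dist r w = 1 := by
            have := hmax w hw
            have : G.dist r w ≠ 0 := fun h =>
              hvw (hrp'.symm.trans (hw.dist_eq_zero_iff.1 h))
            omega
          rw [hrp', dist_eq_one_iff_adj] at hw1
          rcases hnbr hw1 with h | h | h
          exacts [huw.ne h.symm, hzwne h.symm, hqw h.symm]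
        · obtain ⟨c, hc, -, hcd⟩ := exists_adj_dist_succ hv h0
          rcases hnbr hc with rfl | rfl | rfl <;> omega
      · obtain ⟨c, d, hc, hd, hcD, hdD⟩ := parents hpD
        exact ⟨z, q, c, d, hvD, hpD, hzv.symm, hqp.symm, hc, hd, hzD, hqD, hcD, hdD, hzu, hqu,
          hzq'⟩
    · exact absurd (hzq'.trans ((Adj.reachable (G := G.isolate {v, w}) ⟨hqp, hqS, hpS⟩).trans
        (reachable_isolate_root hS hrp hpS (by omega)))) hbad

/-- Isolating `v` and `w` makes `u` isolated and gains the edge `uv`. The cases differ in whether a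
further vertex of the last class loses its connection to the root. -/
lemma hasURBound_of_deepest_degree_two [Finite V] {G : SimpleGraph V} (hG : G.IsSubcubic)
    (ih : ∀ G' : SimpleGraph V, G'.IsSubcubic → G'.size < G.size → G'.HasURBound)
    (hleaf : ∀ a b, G.Adj a b → ∃ c, G.Adj a c ∧ c ≠ b)
    {r u : V} {D : ℕ} (hmax : ∀ z, G.Reachable r z → G.dist r z ≤ D)
    (hdeg : G.DeepestDegreeTwo r D) (hu : G.Reachable r u) (huD : G.dist r u = D) :
    G.HasURBound := by
  classical
  obtain ⟨v, w, hvw, huv, huw, hv, hvD, hN⟩ := hdeg u hu huD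
  have hw : G.Reachable r w := hu.trans huw.reachable
  have hwD : D ≤ G.dist r w + 1 := huD ▸ dist_le_dist_add_one_of_adj hw huw.symm
  have hS : ∀ s ∈ ({v, w} : Set V), D ≤ G.dist r s + 1 := by
    rintro s (rfl | rfl)
    · omega
    · exact hwD
  have hSr : ∀ s ∈ ({v, w} : Set V), G.Reachable r s := by
    rintro s (rfl | rfl) <;> assumption
  have hlt : (G.isolate {v, w}).size < G.size := size_isolate_lt huv.symm (by simp)
  have hih := ih _ (hG.mono (isolate_le _ _)) hlt
  by_cases hbad : ∃ z, G.Reachable r z ∧ G.dist r z = D ∧ z ≠ u ∧ z ∉ ({v, w} : Set V) ∧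
      ¬ (G.isolate {v, w}).Reachable z r
  · have parent : ∀ z, G.Reachable r z → G.dist r z = D → z ∉ ({v, w} : Set V) →
        ¬ (G.isolate {v, w}).Reachable z r →
        ∃ p ∈ ({v, w} : Set V), G.Adj z p ∧ G.dist r p + 1 = D := by
      intro z hz hzD hzS hbad
      obtain ⟨p, -, -, hzp, -, hrp, hpD, -⟩ := hdeg z hz hzD
      refine ⟨p, ?_, hzp, hpD⟩
      by_contra hpS
      exact hbad ((Adj.reachable (G := G.isolate {v, w}) ⟨hzp, hzS, hpS⟩).trans
        (reachable_isolate_root hS hrp hpS (by omega)))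
    obtain ⟨a, b, c, d, h⟩ : ∃ a b c d, CutOffData G r D u v w a b c d := by
      obtain ⟨z, hz, hzD, hzu, hzS, hzr⟩ := hbad
      obtain ⟨p, rfl | rfl, hzp, hpD⟩ := parent z hz hzD hzS hzr
      · exact exists_cutOffData hG hmax hdeg hu huD huv huw hvw hN hvD hz hzD hzu hzS hzr hzp
      · rw [Set.pair_comm] at hzS hzr
        obtain ⟨a, b, c, d, h⟩ := exists_cutOffData hG hmax hdeg hu huD huw huv hvw.symm
          (fun y hy => (hN y hy).symm) hpD hz hzD hzu hzS hzr hzp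
        exact ⟨b, a, d, c, h.swap⟩
    obtain ⟨-, hwD', hva, hwb, hvc, hwd, haD, hbD, hcD, hdD, hau, hbu, hab⟩ := h
    have hinj : ∀ x : V, Function.Injective (fun y => s(x, y)) :=
      fun x y y' h => Sym2.congr_right.1 h
    have huc : u ≠ c := by rintro rfl; omega
    have hud : u ≠ d := by rintro rfl; omega
    have hac : a ≠ c := by rintro rfl; omega
    have hbd : b ≠ d := by rintro rfl; omega
    -- Four new components against six edges: 3 · 4 ≤ 6 + 6. Since `v` and `w` have degree three,
    -- every other cut-off vertex is `a` or `b`, and these stay connected.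
    refine hasURBound_of_isolate_of_adj {v, w} {u, v, w, a}
      (({u, a, c} : Finset V).image (fun y => s(v, y)) ∪
        ({u, b, d} : Finset V).image (fun y => s(w, y))) hih ?_
      (reachable_isolate_of_component hSr ?_) huv hN ?_
    · intro e he
      rcases Finset.mem_union.1 he with he | he <;> obtain ⟨x, hx, rfl⟩ := Finset.mem_image.1 he
      · refine ⟨?_, v, by simp, by simp⟩
        simp only [Finset.mem_insert, Finset.mem_singleton] at hx
        rcases hx with rfl | rfl | rfl
        exacts [huv.symm, hva, hvc]
      · refine ⟨?_, w, by simp, by simp⟩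
        simp only [Finset.mem_insert, Finset.mem_singleton] at hx
        rcases hx with rfl | rfl | rfl
        exacts [huw.symm, hwb, hwd]
    · intro z hz
      by_cases hzX : z ∈ ({u, v, w} : Finset V)
      · exact .inr ⟨z, by simp only [Finset.mem_insert, Finset.mem_singleton] at hzX ⊢; tauto, .rfl⟩
      simp only [Finset.mem_insert, Finset.mem_singleton, not_or] at hzX
      obtain ⟨hzu, hzv, hzw⟩ := hzX
      have hzS : z ∉ ({v, w} : Set V) := by simp [hzv, hzw]
      by_cases hzr : (G.isolate {v, w}).Reachable z r
      · exact .inl hzr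
      have hzD : G.dist r z = D := by
        by_contra hne
        have := hmax z hz
        exact hzr (reachable_isolate_root hS hz hzS (by omega))
      right
      refine ⟨a, by simp, ?_⟩
      obtain ⟨p, rfl | rfl, hzp, hpD⟩ := parent z hz hzD hzS hzr
      · rcases hG.eq_of_adj huv.symm hva hvc hzp.symm hau.symm huc hac with rfl | rfl | rfl
        · exact absurd rfl hzu
        · exact .rfl
        · omega
      · rcases hG.eq_of_adj huw.symm hwb hwd hzp.symm hbu.symm hud hbd with rfl | rfl | rfl
        · exact absurd rfl hzu
        · exact hab.symm
        · omega
    -- Only the edge `vw` could be counted twice, but `v` has distance `D - 1`, unlike `u`, `b` and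
    -- `d`.
    · have hdisj : Disjoint (({u, a, c} : Finset V).image (fun y => s(v, y)))
          (({u, b, d} : Finset V).image (fun y => s(w, y))) := by
        rw [Finset.disjoint_left]
        intro e he he'
        obtain ⟨x, hx, rfl⟩ := Finset.mem_image.1 he
        obtain ⟨y, hy, hxy⟩ := Finset.mem_image.1 he'
        rcases Sym2.eq_iff.1 hxy with ⟨h, -⟩ | ⟨-, h⟩
        · exact hvw h.symm
        · simp only [Finset.mem_insert, Finset.mem_singleton] at hy
          rcases hy with rfl | rfl | rfl
          · exact huv.ne h
          · rw [h] at hbD; omega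
          · rw [h] at hdD; omega
      rw [Finset.card_union_of_disjoint hdisj, Finset.card_image_of_injective _ (hinj v),
        Finset.card_image_of_injective _ (hinj w),
        Finset.card_eq_three.2 ⟨u, a, c, hau.symm, huc, hac, rfl⟩,
        Finset.card_eq_three.2 ⟨u, b, d, hbu.symm, hud, hbd, rfl⟩]
      have : ({u, v, w, a} : Finset V).card ≤ 4 := Finset.card_le_four
      omega
  · push Not at hbad
    obtain ⟨x, hwx, hxu⟩ := hleaf w u huw.symm
    -- Three new components against three edges: 3 · 3 ≤ 3 + 6. The third edge exists because `w` is
    -- not a leaf; `x = v` is allowed.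
    refine hasURBound_of_isolate_of_adj {v, w} {u, v, w} {s(u, v), s(u, w), s(w, x)} hih ?_
      (reachable_isolate_of_component hSr ?_) huv hN ?_
    · intro e he
      simp only [Finset.mem_insert, Finset.mem_singleton] at he
      rcases he with rfl | rfl | rfl
      exacts [⟨huv, v, by simp, by simp⟩, ⟨huw, w, by simp, by simp⟩, ⟨hwx, w, by simp, by simp⟩]
    · intro z hz
      by_cases hzX : z ∈ ({u, v, w} : Finset V)
      · exact .inr ⟨z, hzX, .rfl⟩
      simp only [Finset.mem_insert, Finset.mem_singleton, not_or] at hzX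
      obtain ⟨hzu, hzv, hzw⟩ := hzX
      have hzS : z ∉ ({v, w} : Set V) := by simp [hzv, hzw]
      left
      by_cases hzD : G.dist r z = D
      · exact hbad z hz hzD hzu hzS
      · have := hmax z hz
        exact reachable_isolate_root hS hz hzS (by omega)
    · rw [Finset.card_eq_three.2 ⟨s(u, v), s(u, w), s(w, x), ?_, ?_, ?_, rfl⟩]
      · have : ({u, v, w} : Finset V).card ≤ 3 := Finset.card_le_three
        omega
      · exact fun h => hvw (Sym2.congr_right.1 h)
      · intro h
        rcases Sym2.eq_iff.1 h with ⟨h, -⟩ | ⟨-, h⟩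
        exacts [huw.ne h, hvw h]
      · intro h
        rcases Sym2.eq_iff.1 h with ⟨h, -⟩ | ⟨h, -⟩
        exacts [huw.ne h, hxu h.symm]

/-! ### The induction and the lower bound -/

theorem IsSubcubic.hasURBound [Finite V] {G : SimpleGraph V} (hG : G.IsSubcubic) :
    G.HasURBound := by
  classical
  induction hn : G.size using Nat.strong_induction_on generalizing G with
  | _ n ihn =>
  subst hn
  have ih : ∀ G' : SimpleGraph V, G'.IsSubcubic → G'.size < G.size → G'.HasURBound :=
    fun G' h hlt => ihn _ hlt h rfl
  by_cases hleaf : ∃ u v, G.Adj u v ∧ ∀ y, G.Adj u y → y = v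
  · obtain ⟨u, v, huv, h⟩ := hleaf
    exact hasURBound_of_leaf hG ih huv h
  push Not at hleaf
  by_cases hedge : ∀ a b, ¬ G.Adj a b
  · exact hasURBound_of_forall_not_adj hedge
  push Not at hedge
  obtain ⟨r, a, hra⟩ := hedge
  obtain ⟨u, hu, hmax⟩ := Set.exists_max_image {z | G.Reachable r z} (G.dist r)
    (Set.toFinite _) ⟨r, .rfl⟩
  have hu0 : G.dist r u ≠ 0 := by
    have h1 := hmax a hra.reachable
    rw [dist_eq_one_iff_adj.2 hra] at h1
    omega
  by_cases h3 : ∃ z a b c, G.Reachable r z ∧ G.dist r z = G.dist r u ∧ G.Adj z a ∧ G.Adj z b ∧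
      G.Adj z c ∧ a ≠ b ∧ a ≠ c ∧ b ≠ c
  · obtain ⟨z, a, b, c, hz, hzD, ha, hb, hc, hab, hac, hbc⟩ := h3
    exact hasURBound_of_deepest_degree_three hG ih (fun y hy => hzD ▸ hmax y hy) hz
      (hzD ▸ hu0) ha hb hc hab hac hbc
  · push Not at h3
    refine hasURBound_of_deepest_degree_two hG ih hleaf hmax (fun z hz hzD => ?_) hu rfl
    obtain ⟨p, hzp, hrp, hp⟩ := exists_adj_dist_succ hz (by omega)
    obtain ⟨q, hzq, hqp⟩ := hleaf z p hzp
    refine ⟨p, q, hqp.symm, hzp, hzq, hrp, by omega, fun y hy => ?_⟩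
    by_contra! hne
    exact hne.2 (h3 z p q y hz hzD hzp hzq hy hqp.symm hne.1.symm).symm

theorem IsSubcubic.le_urMatchingNumber [Finite V] {G : SimpleGraph V} (hG : G.IsSubcubic) :
    3 * G.order ≤ 3 * G.numComponents + G.size + 6 * G.urMatchingNumber := by
  obtain ⟨H, hH, hb⟩ := hG.hasURBound
  have := hH.ncard_le
  unfold order
  omega

/-! ### Upper bounds by labelling, and extremal trees -/

lemma Subgraph.ncard_edgeSet_le_of_label {G : SimpleGraph V} (M : G.Subgraph) {L : Type*}
    [Finite L] (R : Sym2 V → L → Prop) (hex : ∀ e ∈ M.edgeSet, ∃ l, R e l)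
    (huniq : ∀ e ∈ M.edgeSet, ∀ e' ∈ M.edgeSet, ∀ l, R e l → R e' l → e = e') :
    M.edgeSet.ncard ≤ Nat.card L := by
  choose f hf using hex
  rw [← Nat.card_coe_set_eq]
  refine Nat.card_le_card_of_injective (fun e : M.edgeSet => f e e.2) fun e e' h => ?_
  have h' : f e e.2 = f e' e'.2 := h
  exact Subtype.ext (huniq _ e.2 _ e'.2 _ (hf _ e.2) (h' ▸ hf _ e'.2))

lemma Subgraph.IsMatching.eq_of_mem {G : SimpleGraph V} {M : G.Subgraph} (hM : M.IsMatching)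
    {e e' : Sym2 V} (he : e ∈ M.edgeSet) (he' : e' ∈ M.edgeSet) {v : V} (hv : v ∈ e)
    (hv' : v ∈ e') : e = e' := by
  obtain ⟨a, rfl⟩ := hv
  obtain ⟨b, rfl⟩ := hv'
  exact congrArg (fun x => s(v, x)) (hM.eq_of_adj_left he he')

/-- The path `0, 1, 3, 4, 6, …, 3 * k` with a pendant vertex `3 * i + 2` attached to every
`3 * i + 1`. -/
def caterpillar (k : ℕ) : SimpleGraph (Fin (3 * k + 1)) :=
  fromRel fun x y => (x : ℕ) % 3 = 1 ∧
    ((y : ℕ) + 1 = x ∨ (y : ℕ) = x + 1 ∨ (y : ℕ) = x + 2)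

lemma caterpillar_adj {k : ℕ} {x y : Fin (3 * k + 1)} : (caterpillar k).Adj x y ↔
    ((x : ℕ) % 3 = 1 ∧ ((y : ℕ) + 1 = x ∨ (y : ℕ) = x + 1 ∨ (y : ℕ) = x + 2)) ∨
    ((y : ℕ) % 3 = 1 ∧ ((x : ℕ) + 1 = y ∨ (x : ℕ) = y + 1 ∨ (x : ℕ) = y + 2)) := by
  rw [caterpillar, fromRel_adj, and_iff_right_iff_imp]
  rintro h rfl
  omega

lemma caterpillar_isTree (k : ℕ) : (caterpillar k).IsTree := by
  classical
  have hreach : ∀ n (hn : n < 3 * k + 1), (caterpillar k).Reachable 0 ⟨n, hn⟩ := by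
    intro n
    induction n using Nat.strong_induction_on with
    | _ n ih =>
      intro hn
      by_cases h0 : n = 0
      · subst h0; exact .rfl
      by_cases h3 : n % 3 = 0
      · exact (ih (n - 2) (by omega) (by omega)).trans
          (Adj.reachable (caterpillar_adj.2 (by simp only; omega)))
      · exact (ih (n - 1) (by omega) (by omega)).trans
          (Adj.reachable (caterpillar_adj.2 (by simp only; omega)))
  have hconn : (caterpillar k).Connected :=
    { preconnected := fun x y => (hreach x x.2).symm.trans (hreach y y.2)
      nonempty := ⟨0⟩ }
  refine isTree_iff_connected_and_card.2 ⟨hconn, le_antisymm ?_ ?_⟩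
  -- Every edge joins a nonzero vertex to its unique smaller neighbor, so there are at most `3 * k`
  -- edges.
  · let par : Fin (3 * k + 1) → Fin (3 * k + 1) := fun x =>
      ⟨if (x : ℕ) % 3 = 0 then x - 2 else x - 1, by have := x.2; split_ifs <;> omega⟩
    have hsub : (caterpillar k).edgeSet ⊆
        ((Finset.univ.erase (0 : Fin (3 * k + 1))).image fun x => s(x, par x) : Finset _) := by
      intro e he
      induction e with
      | _ x y =>
        have key : ∀ x y : Fin (3 * k + 1), (caterpillar k).Adj x y → y < x →
            s(x, y) ∈ ((Finset.univ.erase (0 : Fin (3 * k + 1))).image fun x => s(x, par x)) := by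
          intro x y hxy hlt
          rw [caterpillar_adj] at hxy
          have hlt' : (y : ℕ) < x := hlt
          have hpar : par x = y := by
            ext
            simp only [par]
            split_ifs <;> omega
          refine Finset.mem_image.2 ⟨x, ?_, by rw [hpar]⟩
          simp only [Finset.mem_erase, Finset.mem_univ, and_true]
          rintro rfl
          exact absurd hlt' (by simp)
        rcases lt_trichotomy x y with h | h | h
        · rw [Sym2.eq_swap]
          exact key y x (he.symm) h
        · exact absurd h (Adj.ne (G := caterpillar k) he)
        · exact key x y he h
    have h1 := Set.ncard_le_ncard hsub (Finset.finite_toSet _)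
    rw [Set.ncard_coe_finset] at h1
    have h2 := h1.trans Finset.card_image_le
    rw [Finset.card_erase_of_mem (Finset.mem_univ _), Finset.card_univ, Fintype.card_fin] at h2
    rw [Nat.card_coe_set_eq, Nat.card_fin]
    omega
  · exact hconn.card_vert_le_card_edgeSet_add_one

lemma caterpillar_isSubcubic (k : ℕ) : (caterpillar k).IsSubcubic := by
  classical
  intro x
  rw [← Set.InjOn.encard_image (f := fun y : Fin (3 * k + 1) => (y : ℕ))
    (Fin.val_injective.injOn)]
  by_cases h : (x : ℕ) % 3 = 1
  · refine (Set.encard_le_encard (t := (({(x : ℕ) - 1, (x : ℕ) + 1, (x : ℕ) + 2} : Finset ℕ) : Set ℕ)) ?_).trans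
      ?_
    · rintro _ ⟨y, hy, rfl⟩
      rw [mem_neighborSet, caterpillar_adj] at hy
      simp only [Finset.coe_insert, Finset.coe_singleton, Set.mem_insert_iff,
        Set.mem_singleton_iff]
      omega
    · rw [Set.encard_coe_eq_coe_finsetCard]
      exact_mod_cast Finset.card_le_three
  · refine (Set.encard_le_encard
      (t := (({(x : ℕ) - 1, (x : ℕ) + 1, (x : ℕ) - 2} : Finset ℕ) : Set ℕ)) ?_).trans ?_
    · rintro _ ⟨y, hy, rfl⟩
      rw [mem_neighborSet, caterpillar_adj] at hy
      simp only [Finset.coe_insert, Finset.coe_singleton, Set.mem_insert_iff,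
        Set.mem_singleton_iff]
      omega
    · rw [Set.encard_coe_eq_coe_finsetCard]
      exact_mod_cast Finset.card_le_three

lemma numComponents_eq_one_of_connected {G : SimpleGraph V} (hG : G.Connected) :
    G.numComponents = 1 := by
  have := hG.preconnected.subsingleton_connectedComponent
  obtain ⟨v⟩ := hG.nonempty
  exact Nat.card_eq_one_iff_unique.2 ⟨this, ⟨G.connectedComponentMk v⟩⟩

lemma IsTree.size_add_one [Finite V] {T : SimpleGraph V} (hT : T.IsTree) :
    T.size + 1 = T.order := by
  have := (isTree_iff_connected_and_card.1 hT).2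
  rwa [Nat.card_coe_set_eq] at this

/-- The `k` vertices congruent to 1 modulo 3 meet every edge, which bounds every matching; the
general bound for a tree of order `3 * k + 1` gives the converse. -/
lemma caterpillar_urMatchingNumber (k : ℕ) : (caterpillar k).urMatchingNumber = k := by
  refine le_antisymm (urMatchingNumber_le _ _ fun M hM => ?_) ?_
  · have := M.ncard_edgeSet_le_of_label (L := Fin k)
      (fun e i => ∃ x ∈ e, (x : ℕ) = 3 * i + 1) ?_ ?_
    · simpa using this
    · intro e he
      induction e with
      | _ x y =>
        have hadj : (caterpillar k).Adj x y := M.adj_sub he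
        have h := caterpillar_adj.1 hadj
        have hx := x.2
        have hy := y.2
        by_cases h1 : (x : ℕ) % 3 = 1
        · exact ⟨⟨x / 3, by omega⟩, x, by simp, by simp only; omega⟩
        · exact ⟨⟨y / 3, by omega⟩, y, by simp, by simp only; omega⟩
    · rintro e he e' he' i ⟨x, hx, hxi⟩ ⟨y, hy, hyi⟩
      obtain rfl : x = y := by ext; omega
      exact hM.1.eq_of_mem he he' hx hy
  · have h1 := (caterpillar_isSubcubic k).le_urMatchingNumber
    have h2 := (caterpillar_isTree k).size_add_one
    have h3 := numComponents_eq_one_of_connected (caterpillar_isTree k).1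
    have h4 : (caterpillar k).order = 3 * k + 1 := by simp [order]
    omega

/-! ### Linked copies of K_{2,3} -/

/-- A uniquely restricted matching does not admit an alternating 4-cycle. -/
lemma Subgraph.IsUniquelyRestrictedMatching.not_swap {G : SimpleGraph V} {M : G.Subgraph}
    (hM : M.IsUniquelyRestrictedMatching) {a b c d : V} (hab : M.Adj a b) (hcd : M.Adj c d)
    (had : G.Adj a d) (hcb : G.Adj c b) (hac : a ≠ c) : False := by
  classical
  have hbd : b ≠ d := fun h => hac (hM.1.eq_of_adj_right hab (h ▸ hcd))
  -- Relabelling `M` by this transposition replaces `ab`, `cd` by `ad`, `cb` and covers the same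
  -- vertices.
  let σ := Equiv.swap b d
  have hσb : σ b = d := Equiv.swap_apply_left _ _
  have hσd : σ d = b := Equiv.swap_apply_right _ _
  have hσ : ∀ x, x ≠ b → x ≠ d → σ x = x := fun x => Equiv.swap_apply_of_ne_of_ne
  have hσσ : ∀ x, σ (σ x) = x := fun x => by simp [σ]
  have hσa : σ a = a := hσ a hab.ne had.ne
  have hσc : σ c = c := hσ c hcb.ne hcd.ne
  have hGb : ∀ y, M.Adj d (σ y) → G.Adj b y := by
    intro y hy
    have : σ y = c := hM.1.eq_of_adj_left hy hcd.symm
    rw [← hσσ y, this, hσc]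
    exact hcb.symm
  have hGd : ∀ y, M.Adj b (σ y) → G.Adj d y := by
    intro y hy
    have : σ y = a := hM.1.eq_of_adj_left hy hab.symm
    rw [← hσσ y, this, hσa]
    exact had.symm
  have hverts : ∀ x, σ x ∈ M.verts → x ∈ M.verts := by
    intro x hx
    by_cases hxb : x = b
    · rw [hxb]; exact hab.snd_mem
    by_cases hxd : x = d
    · rw [hxd]; exact hcd.snd_mem
    rwa [hσ x hxb hxd] at hx
  have hverts' : ∀ x, x ∈ M.verts → σ x ∈ M.verts := fun x hx =>
    hverts _ (by rwa [hσσ])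
  let N : G.Subgraph :=
    { verts := M.verts
      Adj := fun x y => M.Adj (σ x) (σ y)
      adj_sub := by
        intro x y hxy
        by_cases hxb : x = b
        · subst hxb; rw [hσb] at hxy; exact hGb y hxy
        by_cases hxd : x = d
        · subst hxd; rw [hσd] at hxy; exact hGd y hxy
        by_cases hyb : y = b
        · subst hyb; rw [hσb] at hxy; exact (hGb x hxy.symm).symm
        by_cases hyd : y = d
        · subst hyd; rw [hσd] at hxy; exact (hGd x hxy.symm).symm
        rw [hσ x hxb hxd, hσ y hyb hyd] at hxy
        exact M.adj_sub hxy
      edge_vert := fun h => hverts _ (M.edge_vert h)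
      symm := ⟨fun _ _ h => Subgraph.Adj.symm h⟩ }
  have hN : N.IsMatching := by
    intro x hx
    obtain ⟨y, hy, hy'⟩ := hM.1 (hverts' x hx)
    refine ⟨σ y, ?_, fun z hz => ?_⟩
    · change M.Adj (σ x) (σ (σ y))
      rwa [hσσ]
    · rw [← hy' _ hz, hσσ]
  have hNM := hM.2 N hN rfl
  have had' : N.Adj a d := by
    change M.Adj (σ a) (σ d)
    rwa [hσa, hσd]
  rw [hNM] at had'
  exact hbd (hM.1.eq_of_adj_left hab had')

lemma linkedK23_adj_copy {k : ℕ} {a : Fin k → Fin 3 → Fin 2 ⊕ Fin 3} {c d : Fin (2 * k + 1)}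
    {v w : Fin 2 ⊕ Fin 3} : (linkedK23 k a).Adj (.inr (c, v)) (.inr (d, w)) ↔
      c = d ∧ (completeBipartiteGraph (Fin 2) (Fin 3)).Adj v w := Iff.rfl

lemma linkedK23_adj_link {k : ℕ} {a : Fin k → Fin 3 → Fin 2 ⊕ Fin 3} {i : Fin k}
    {c : Fin (2 * k + 1)} {v : Fin 2 ⊕ Fin 3} : (linkedK23 k a).Adj (.inl i) (.inr (c, v)) ↔
      ∃ j : Fin 3, (c : ℕ) = 2 * (i : ℕ) + (j : ℕ) ∧ v = a i j := Iff.rfl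

lemma linkedK23_adj_link' {k : ℕ} {a : Fin k → Fin 3 → Fin 2 ⊕ Fin 3} {i : Fin k}
    {c : Fin (2 * k + 1)} {v : Fin 2 ⊕ Fin 3} : (linkedK23 k a).Adj (.inr (c, v)) (.inl i) ↔
      ∃ j : Fin 3, (c : ℕ) = 2 * (i : ℕ) + (j : ℕ) ∧ v = a i j := Iff.rfl

lemma linkedK23_not_adj {k : ℕ} {a : Fin k → Fin 3 → Fin 2 ⊕ Fin 3} {i j : Fin k} :
    ¬ (linkedK23 k a).Adj (.inl i) (.inl j) := id

/-- The `j`-th link ends at the `j`-th vertex of the side of size three, whose vertices have degree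
two in the copy. A copy with two links receives them with `j = 0` and `j = 2`, at different
vertices. -/
lemma linkedK23_isSubcubic (k : ℕ) : (linkedK23 k fun _ j => .inr j).IsSubcubic := by
  classical
  have key : ∀ (x) (f : Fin 3 → Fin k ⊕ (Fin (2 * k + 1) × (Fin 2 ⊕ Fin 3))),
      (∀ y, (linkedK23 k fun _ j => .inr j).Adj x y → ∃ j, f j = y) →
      ((linkedK23 k fun _ j => .inr j).neighborSet x).encard ≤ 3 := by
    intro x f hf
    refine (Set.encard_le_encard (t := ((Finset.univ.image f : Finset _) : Set _)) ?_).trans ?_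
    · intro y hy
      obtain ⟨j, rfl⟩ := hf y hy
      simp
    · rw [Set.encard_coe_eq_coe_finsetCard]
      exact_mod_cast Finset.card_image_le
  rintro (i | ⟨c, p | q⟩)
  · refine key _ (fun j => .inr (⟨2 * i + j, by omega⟩, .inr j)) ?_
    rintro (i' | ⟨d, v⟩) h
    · exact absurd h linkedK23_not_adj
    · obtain ⟨j, hj, rfl⟩ := linkedK23_adj_link.1 h
      refine ⟨j, ?_⟩
      congr 2
      exact Fin.ext hj.symm
  · refine key _ (fun j => .inr (c, .inr j)) ?_
    rintro (i' | ⟨d, p' | q'⟩) h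
    · obtain ⟨j, -, hj⟩ := linkedK23_adj_link'.1 h
      simp at hj
    · simp [linkedK23_adj_copy] at h
    · obtain ⟨rfl, -⟩ := linkedK23_adj_copy.1 h
      exact ⟨q', rfl⟩
  -- The only possible link vertex has index `(c - q) / 2`; the last branch is a filler for indices
  -- out of range.
  · refine key _ (fun j => if h : (j : ℕ) < 2 then .inr (c, .inl ⟨j, h⟩) else
      if h : ((c : ℕ) - q) / 2 < k then .inl ⟨((c : ℕ) - q) / 2, h⟩ else .inr (c, .inr q)) ?_
    rintro (i' | ⟨d, p' | q'⟩) h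
    · obtain ⟨j, hj, hq⟩ := linkedK23_adj_link'.1 h
      obtain rfl : q = j := Sum.inr.inj hq
      have hi : ((c : ℕ) - q) / 2 = i' := by omega
      exact ⟨2, by simp [hi]⟩
    · obtain ⟨rfl, -⟩ := linkedK23_adj_copy.1 h
      have hp := p'.2
      exact ⟨⟨p', by omega⟩, dif_pos hp⟩
    · simp [linkedK23_adj_copy] at h

lemma linkedK23_order (k : ℕ) (a : Fin k → Fin 3 → Fin 2 ⊕ Fin 3) :
    (linkedK23 k a).order = 11 * k + 5 := by
  simp only [order, Nat.card_eq_fintype_card, Fintype.card_sum, Fintype.card_prod,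
    Fintype.card_fin]
  ring

lemma linkedK23_size (k : ℕ) (a : Fin k → Fin 3 → Fin 2 ⊕ Fin 3) :
    (linkedK23 k a).size = 15 * k + 6 := by
  -- An enumeration of the edges: `3 * k` links and `6 * (2 * k + 1)` edges inside copies.
  let f : (Fin k × Fin 3) ⊕ (Fin (2 * k + 1) × Fin 2 × Fin 3) →
      Sym2 (Fin k ⊕ (Fin (2 * k + 1) × (Fin 2 ⊕ Fin 3))) :=
    Sum.elim (fun p => s(.inl p.1, .inr (⟨2 * p.1 + p.2, by omega⟩, a p.1 p.2)))
      (fun p => s(.inr (p.1, .inl p.2.1), .inr (p.1, .inr p.2.2)))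
  have hf : Function.Injective f := by
    rintro (⟨i, j⟩ | ⟨c, p, q⟩) (⟨i', j'⟩ | ⟨c', p', q'⟩) h
    · simp only [f, Sum.elim_inl, Sym2.eq_iff, Sum.inl.injEq, Sum.inr.injEq, Prod.mk.injEq,
        Fin.mk.injEq, reduceCtorEq, false_and, or_false] at h
      obtain ⟨rfl, h, -⟩ := h
      obtain rfl : j = j' := Fin.ext (by omega)
      rfl
    · simp [f] at h
    · simp [f] at h
    · simp only [f, Sum.elim_inr, Sym2.eq_iff, Sum.inl.injEq, Sum.inr.injEq, Prod.mk.injEq,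
        reduceCtorEq, and_false, or_false] at h
      obtain ⟨⟨rfl, rfl⟩, -, rfl⟩ := h
      rfl
  have hrange : Set.range f = (linkedK23 k a).edgeSet := by
    ext e
    constructor
    · rintro ⟨⟨i, j⟩ | ⟨c, p, q⟩, rfl⟩
      · exact linkedK23_adj_link.2 ⟨j, rfl, rfl⟩
      · exact (linkedK23_adj_copy (a := a)).2 ⟨rfl, by simp⟩
    · induction e with
      | _ x y =>
        intro h
        rw [mem_edgeSet] at h
        rcases x with i | ⟨c, v⟩ <;> rcases y with i' | ⟨d, w⟩
        · exact absurd h linkedK23_not_adj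
        · obtain ⟨j, hj, rfl⟩ := linkedK23_adj_link.1 h
          refine ⟨.inl (i, j), ?_⟩
          obtain rfl : d = ⟨2 * i + j, by clear hj; omega⟩ := Fin.ext hj
          rfl
        · obtain ⟨j, hj, rfl⟩ := linkedK23_adj_link'.1 h
          refine ⟨.inl (i', j), ?_⟩
          obtain rfl : c = ⟨2 * i' + j, by clear hj; omega⟩ := Fin.ext hj
          exact Sym2.eq_swap
        · obtain ⟨rfl, hvw⟩ := linkedK23_adj_copy.1 h
          rcases v with p | q <;> rcases w with p' | q'
          · simp at hvw
          · exact ⟨.inr (c, p, q'), rfl⟩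
          · exact ⟨.inr (c, p', q), Sym2.eq_swap⟩
          · simp at hvw
  rw [size, ← hrange, ← Set.image_univ, Set.ncard_image_of_injective _ hf, Set.ncard_univ]
  simp only [Nat.card_eq_fintype_card, Fintype.card_sum, Fintype.card_prod, Fintype.card_fin]
  ring

lemma linkedK23_connected (k : ℕ) (a : Fin k → Fin 3 → Fin 2 ⊕ Fin 3) :
    (linkedK23 k a).Connected := by
  set G := linkedK23 k a with hG
  have hcopy0 : ∀ (c : Fin (2 * k + 1)) v, G.Reachable (.inr (c, .inl 0)) (.inr (c, v)) := by
    intro c v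
    have hadj : ∀ p q, G.Adj (.inr (c, .inl p)) (.inr (c, .inr q)) :=
      fun p q => linkedK23_adj_copy.2 ⟨rfl, by simp⟩
    rcases v with p | q
    · exact (hadj 0 0).reachable.trans (hadj p 0).symm.reachable
    · exact (hadj 0 q).reachable
  have hcopy : ∀ (c : Fin (2 * k + 1)) v w, G.Reachable (.inr (c, v)) (.inr (c, w)) :=
    fun c v w => (hcopy0 c v).symm.trans (hcopy0 c w)
  have hlink : ∀ (i : Fin k) (j : Fin 3),
      G.Adj (.inl i) (.inr (⟨2 * i + j, by omega⟩, a i j)) :=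
    fun i j => linkedK23_adj_link.2 ⟨j, rfl, rfl⟩
  have hjoin : ∀ (i : Fin k) (j j' : Fin 3) v w,
      G.Reachable (.inr (⟨2 * i + j, by omega⟩, v)) (.inr (⟨2 * i + j', by omega⟩, w)) :=
    fun i j j' v w => (hcopy _ _ _).trans ((hlink i j).symm.reachable.trans
      ((hlink i j').reachable.trans (hcopy _ _ _)))
  have hall : ∀ n (hn : n < 2 * k + 1) v,
      G.Reachable (.inr (0, .inl 0)) (.inr (⟨n, hn⟩, v)) := by
    intro n
    induction n using Nat.strong_induction_on with
    | _ n ih =>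
      intro hn v
      by_cases h0 : n = 0
      · subst h0; exact hcopy _ _ _
      -- For `n > 0`, this link vertex joins copy `n` to the earlier copy `2 * i`.
      let i : Fin k := ⟨(n - 1) / 2, by omega⟩
      let j : Fin 3 := ⟨n - 2 * ((n - 1) / 2), by omega⟩
      have h1 := ih (2 * ((n - 1) / 2)) (by omega) (by omega) v
      have h2 := hjoin i 0 j v v
      have e2 : 2 * (i : ℕ) + j = n := by simp only [i, j]; omega
      simp only [e2] at h2
      exact h1.trans h2
  have hroot : ∀ x, G.Reachable (.inr (0, .inl 0)) x := by
    rintro (i | ⟨c, v⟩)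
    · exact (hall _ _ _).trans (hlink i 0).symm.reachable
    · exact hall c c.2 v
  exact { preconnected := fun x y => (hroot x).symm.trans (hroot y)
          nonempty := ⟨.inr (0, .inl 0)⟩ }

/-- Each link vertex lies in at most one matching edge, and each copy contains at most one, since
two disjoint edges of K_{2,3} lie on a 4-cycle. This gives k + (2k + 1). -/
lemma linkedK23_urMatchingNumber_le (k : ℕ) (a : Fin k → Fin 3 → Fin 2 ⊕ Fin 3) :
    (linkedK23 k a).urMatchingNumber ≤ 3 * k + 1 := by
  refine urMatchingNumber_le _ _ fun M hM => ?_
  have := M.ncard_edgeSet_le_of_label (L := Fin k ⊕ Fin (2 * k + 1))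
    (fun e => Sum.elim (fun i => .inl i ∈ e)
      (fun c => ∃ p q, e = s(.inr (c, .inl p), .inr (c, .inr q)))) ?_ ?_
  · rw [Nat.card_sum, Nat.card_fin, Nat.card_fin] at this
    omega
  · intro e he
    induction e with
    | _ x y =>
      have h := M.adj_sub he
      rcases x with i | ⟨c, v⟩
      · exact ⟨.inl i, by simp⟩
      rcases y with i | ⟨d, w⟩
      · exact ⟨.inl i, by simp⟩
      obtain ⟨rfl, hvw⟩ := linkedK23_adj_copy.1 h
      refine ⟨.inr c, ?_⟩
      rcases v with p | q <;> rcases w with p' | q'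
      · simp at hvw
      · exact ⟨p, q', rfl⟩
      · exact ⟨p', q, Sym2.eq_swap⟩
      · simp at hvw
  · rintro e he e' he' (i | c) h h'
    · exact hM.1.eq_of_mem he he' h h'
    · obtain ⟨p, q, rfl⟩ := h
      obtain ⟨p', q', rfl⟩ := h'
      by_cases hp : p = p'
      · subst hp
        exact hM.1.eq_of_mem he he' (Sym2.mem_mk_left _ _) (Sym2.mem_mk_left _ _)
      · exact (hM.not_swap he he' (linkedK23_adj_copy.2 ⟨rfl, by simp⟩)
          (linkedK23_adj_copy.2 ⟨rfl, by simp⟩) (by simpa using hp)).elim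

end SimpleGraph

theorem theorem2 :
    -- the lower bound
    (∀ (V : Type*) [Finite V] (G : SimpleGraph V), G.IsSubcubic →
      ((G.order : ℝ) - (G.numComponents : ℝ)) / 2 - (G.size : ℝ) / 6
        ≤ (G.urMatchingNumber : ℝ)) ∧
    -- for trees the lower bound reads `(n - 1) / 3`
    (∀ (V : Type*) [Finite V] (T : SimpleGraph V), T.IsTree →
      ((T.order : ℝ) - (T.numComponents : ℝ)) / 2 - (T.size : ℝ) / 6
        = ((T.order : ℝ) - 1) / 3) ∧
    -- it is attained by infinitely many subcubic trees
    (∀ N : ℕ, ∃ n : ℕ, N ≤ n ∧ ∃ T : SimpleGraph (Fin n), T.IsTree ∧ T.IsSubcubic ∧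
      (T.urMatchingNumber : ℝ) = ((T.order : ℝ) - 1) / 3) ∧
    -- it is attained by the subcubic graphs built from copies of `K_{2,3}`
    (∀ k : ℕ,
      (∃ a : Fin k → Fin 3 → Fin 2 ⊕ Fin 3, (SimpleGraph.linkedK23 k a).IsSubcubic) ∧
      ∀ a : Fin k → Fin 3 → Fin 2 ⊕ Fin 3, (SimpleGraph.linkedK23 k a).IsSubcubic →
        (SimpleGraph.linkedK23 k a).order = 11 * k + 5 ∧
        (SimpleGraph.linkedK23 k a).size = 15 * k + 6 ∧
        (SimpleGraph.linkedK23 k a).numComponents = 1 ∧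
        (SimpleGraph.linkedK23 k a).urMatchingNumber = 3 * k + 1 ∧
        ((SimpleGraph.linkedK23 k a).urMatchingNumber : ℝ)
          = (((SimpleGraph.linkedK23 k a).order : ℝ)
              - ((SimpleGraph.linkedK23 k a).numComponents : ℝ)) / 2
            - ((SimpleGraph.linkedK23 k a).size : ℝ) / 6) := by
  open SimpleGraph in
  refine ⟨fun V _ G hG => ?_, fun V _ T hT => ?_, fun N => ⟨3 * N + 1, by omega, caterpillar N,
    caterpillar_isTree N, caterpillar_isSubcubic N, ?_⟩,
    fun k => ⟨⟨_, linkedK23_isSubcubic k⟩, fun a ha => ?_⟩⟩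
  · have h : (3 * G.order : ℝ) ≤ 3 * G.numComponents + G.size + 6 * G.urMatchingNumber := by
      exact_mod_cast hG.le_urMatchingNumber
    linarith
  · have h : (T.size + 1 : ℝ) = T.order := by exact_mod_cast hT.size_add_one
    rw [numComponents_eq_one_of_connected hT.1, ← h]
    push_cast
    ring
  · rw [caterpillar_urMatchingNumber, order, Nat.card_fin]
    push_cast
    ring
  · have h1 := linkedK23_order k a
    have h2 := linkedK23_size k a
    have h3 := numComponents_eq_one_of_connected (linkedK23_connected k a)
    -- The general bound reads 3(11k + 5) ≤ 3 + (15k + 6) + 6ν, that is, ν ≥ 3k + 1.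
    have h4 : (linkedK23 k a).urMatchingNumber = 3 * k + 1 := by
      have := linkedK23_urMatchingNumber_le k a
      have := ha.le_urMatchingNumber
      omega
    refine ⟨h1, h2, h3, h4, ?_⟩
    rw [h1, h2, h3, h4]
    push_cast
    ring
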